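/- A \emph{partially-commutative grammar} over a finite alphabet consists of a finite set $V$ of non-terminals with an initial $S\in V$, finitely many productions $X \xrightarrow{a} \alpha$ ($X\in V$, $a$ a letter, $\alpha\in V^*$), and a symmetric irreflexive independence relation $I\subseteq V\times V$; its complement $D=(V\times V)\setminus I$ is called dependence. Configurations are words over $V$. A production step replaces $X\beta$ by $\alpha\beta$ and emits $a$, for a production $X\xrightarrow{a}\alpha$; a swap step replaces $\alpha XY\beta$ by $\alpha YX\beta$ when $(X,Y)\in I$, and emits nothing. The language of the grammar consists of the words emitted along sequences of steps from the configuration $S$ to the empty configuration. $\mathrm{PCCFL}$ is the class of languages of such grammars, $\mathrm{trPCCFL}$ the subclass where $D$ can be chosen transitive, and $\mathrm{CCFL}$ the subclass where any two distinct non-terminals can be chosen independent. $L_1\,\|\,L_2$ denotes the shuffle, i.e. the set of all interleavings of a word of $L_1$ with a word of $L_2$. 1. Neither $\mathrm{PCCFL}$ nor $\mathrm{trPCCFL}$ is closed under intersection with regular languages. In particular, the language $L=\{w\in\{a,b,c\}^* : \#_a(w)=\#_b(w)=\#_c(w)\ge 1\}$ belongs to $\mathrm{CCFL}$ and to $\mathrm{trPCCFL}$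 (hence to $\mathrm{PCCFL}$), the language $a^*b^*c^*$ is regular, and $L\cap a^*b^*c^*=\{a^nb^nc^n : n\ge 1\}$ is not in $\mathrm{PCCFL}$. 2. Neither $\mathrm{PCCFL}$ nor $\mathrm{trPCCFL}$ is closed under inverse images of homomorphisms, even of homomorphisms that map no letter to the empty word. In particular, over the alphabet $\{A,S_1,B_1,T_1,S_2,B_2,T_2,C\}$ the languages $L_1=\{A^{n+1}S_1B_1^nT_1 : n\ge 1\}$ and $L_2=\{S_2B_2^nT_2C^n : n\ge 1\}$ are context-free, their shuffle $L_1\,\|\,L_2$ is in $\mathrm{trPCCFL}$ (hence in $\mathrm{PCCFL}$), and for the homomorphism $h(a)=A$, $h(s)=S_1S_2$, $h(b)=B_1B_2$, $h(t)=T_1T_2$, $h(c)=C$ the inverse image $h^{-1}(L_1\,\|\,L_2)=\{a^{n+1}sb^ntc^n : n\ge 1\}$ is not in $\mathrm{PCCFL}$. -/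

import Mathlib

namespace PartiallyCommutative

/-- A context-free grammar in Greibach form over the alphabet `T`, with finitely many
non-terminals, finitely many productions `X →[a] α` (represented as the triple `(X, a, α)`), and a
symmetric, irreflexive independence relation on the non-terminals. -/
structure Grammar (T : Type) where
  /-- The non-terminals. -/
  NT : Type
  finite_NT : Finite NT
  /-- The initial non-terminal. -/
  initial : NT
  /-- The productions. -/
  productions : Set (NT × T × List NT)
  finite_productions : productions.Finite
  /-- The independence relation. -/
  Indep : NT → NT → Prop
  indep_symm : ∀ X Y, Indep X Y → Indep Y X
  indep_irrefl : ∀ X, ¬ Indep X X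

namespace Grammar

variable {T : Type}

/-- Dependence is the complement of independence. -/
def Dep (G : Grammar T) (X Y : G.NT) : Prop := ¬ G.Indep X Y

/-- `G.Derives α w β`: the configuration `β` can be reached from the configuration `α` by a
sequence of production steps and swap steps that defines the word `w`. -/
inductive Derives (G : Grammar T) : List G.NT → List T → List G.NT → Prop
  | refl (α : List G.NT) : Derives G α [] α
  | production {X : G.NT} {a : T} {γ β δ : List G.NT} {w : List T} :
      (X, a, γ) ∈ G.productions → Derives G (γ ++ β) w δ → Derives G (X :: β) (a :: w) δ
  | swap {X Y : G.NT} {α β δ : List G.NT} {w : List T} :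
      G.Indep X Y → Derives G (α ++ Y :: X :: β) w δ → Derives G (α ++ X :: Y :: β) w δ

/-- The words generated by the initial non-terminal. -/
def language (G : Grammar T) : Language T := {w | G.Derives [G.initial] w []}

end Grammar

/-- The partially-commutative context-free languages. -/
def PCCFL (T : Type) : Set (Language T) := {L | ∃ G : Grammar T, G.language = L}

/-- The partially-commutative context-free languages with transitive dependence. -/
def TrPCCFL (T : Type) : Set (Language T) :=
  {L | ∃ G : Grammar T, (∀ X Y Z, G.Dep X Y → G.Dep Y Z → G.Dep X Z) ∧ G.language = L}

/-- The commutative context-free languages: any two distinct non-terminals are independent. -/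
def CCFL (T : Type) : Set (Language T) :=
  {L | ∃ G : Grammar T, (∀ X Y, X ≠ Y → G.Indep X Y) ∧ G.language = L}

/-- The class `C` is closed under intersection with regular languages (over finite alphabets). -/
def ClosedUnderInterRegular (C : (T : Type) → Set (Language T)) : Prop :=
  ∀ (T : Type) [Finite T] (L R : Language T), L ∈ C T → R.IsRegular → L ⊓ R ∈ C T

/-- The inverse image of `L` under the monoid homomorphism from words over `T` to words over `U`
that extends `h : T → List U`. -/
def inverseImage {T U : Type} (h : T → List U) (L : Language U) : Language T :=
  {w | w.flatMap h ∈ L}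

/-- The class `C` is closed under inverse images of homomorphisms that map no letter to the empty
word (over finite alphabets). -/
def ClosedUnderInverseHom (C : (T : Type) → Set (Language T)) : Prop :=
  ∀ (T U : Type) [Finite T] [Finite U] (h : T → List U), (∀ a, h a ≠ []) →
    ∀ L : Language U, L ∈ C U → inverseImage h L ∈ C T

/-- `Interleaving w v u`: the word `u` is an interleaving of the words `w` and `v`. -/
inductive Interleaving {T : Type} : List T → List T → List T → Prop
  | nil : Interleaving [] [] []
  | left {w v u : List T} (a : T) : Interleaving w v u → Interleaving (a :: w) v (a :: u)
  | right {w v u : List T} (a : T) : Interleaving w v u → Interleaving w (a :: v) (a :: u)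

/-- The shuffle `L ‖ K` of two languages. -/
def shuffle {T : Type} (L K : Language T) : Language T :=
  {u | ∃ w ∈ L, ∃ v ∈ K, Interleaving w v u}

/-- A three-letter alphabet. -/
inductive ABC
  | a | b | c
  deriving DecidableEq

/-- The nonempty words with equally many occurrences of each of `a`, `b`, `c`. -/
def equalCounts : Language ABC :=
  {w | w ≠ [] ∧ w.count ABC.a = w.count ABC.b ∧ w.count ABC.b = w.count ABC.c}

open Computability in
/-- The regular language `a* b* c*`. -/
def aStarBStarCStar : Language ABC :=
  ({[ABC.a]} : Language ABC)∗ * ({[ABC.b]} : Language ABC)∗ * ({[ABC.c]} : Language ABC)∗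

/-- The source alphabet of the homomorphism `hom`. -/
inductive Src
  | a | s | b | t | c

/-- The target alphabet of the homomorphism `hom`. -/
inductive Tgt
  | A | S₁ | B₁ | T₁ | S₂ | B₂ | T₂ | C

/-- `{Aⁿ⁺¹ S₁ B₁ⁿ T₁ : n ≥ 1}` -/
def lang₁ : Language Tgt :=
  {w | ∃ n : ℕ, 1 ≤ n ∧
    w = List.replicate (n + 1) Tgt.A ++ [Tgt.S₁] ++ List.replicate n Tgt.B₁ ++ [Tgt.T₁]}

/-- `{S₂ B₂ⁿ T₂ Cⁿ : n ≥ 1}` -/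
def lang₂ : Language Tgt :=
  {w | ∃ n : ℕ, 1 ≤ n ∧
    w = [Tgt.S₂] ++ List.replicate n Tgt.B₂ ++ [Tgt.T₂] ++ List.replicate n Tgt.C}

/-- The homomorphism `a ↦ A`, `s ↦ S₁S₂`, `b ↦ B₁B₂`, `t ↦ T₁T₂`, `c ↦ C`. -/
def hom : Src → List Tgt
  | .a => [.A]
  | .s => [.S₁, .S₂]
  | .b => [.B₁, .B₂]
  | .t => [.T₁, .T₂]
  | .c => [.C]

end PartiallyCommutative

/-! Swaps affect a generated word only by permuting its letters. By `Derives.exists_perm_yields`,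
every word of a grammar's language has a permutation with a leftmost derivation, and by
`Yields.derives` every word derived leftmost is again in the language. Context-free pumping thus
applies to a permutation of each long word: some `u₁ u x v v₁` and `u₁ u u x v v v₁` with `u ≠ []`
both belong to the language.

Suppose now that all words of the language are sorted for some order of the letters. Then `u u` and
`v v` are sorted, so `u` and `v` each use at most one letter. Among three letters, one occurs in
neither, and pumping leaves its count unchanged. If that count determines the word, the two words
coincide, although their lengths differ. This is `not_mem_PCCFL_of_sorted`, which excludes both
`aⁿbⁿcⁿ` and `aⁿ⁺¹sbⁿtcⁿ`.

On the positive side, a commutative grammar generates `equalCounts` by opening rounds and keeping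
the pending letters as non-terminals. The class `TrPCCFL` is closed under shuffle: non-terminals of
different grammars are made independent. Each of the two context-free languages has a grammar with
no independence at all, hence with transitive dependence. Finally, the homomorphism makes `s`, `b`,
`t` visible to both components of the shuffle, which forces their two block lengths to agree. -/

namespace PartiallyCommutative
-- Leftmost derivations
namespace Grammar

variable {T : Type}

/-- `G.Yields α w`: the word `w` is emitted by a leftmost derivation from `α`, without swaps. -/
inductive Yields (G : Grammar T) : List G.NT → List T → Prop
  | nil : Yields G [] []
  | cons {X : G.NT} {a : T} {γ β : List G.NT} {u v : List T} :
      (X, a, γ) ∈ G.productions → Yields G γ u → Yields G β v → Yields G (X :: β) (a :: (u ++ v))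

variable {G : Grammar T}

theorem Yields.append {α β : List G.NT} {u v : List T} (hα : G.Yields α u) (hβ : G.Yields β v) :
    G.Yields (α ++ β) (u ++ v) := by
  induction hα with
  | nil => exact hβ
  | cons hp hγ _ _ ih => simpa using Yields.cons hp hγ ih

theorem yields_append_iff {α β : List G.NT} {w : List T} :
    G.Yields (α ++ β) w ↔ ∃ u v, G.Yields α u ∧ G.Yields β v ∧ w = u ++ v := by
  refine ⟨fun h => ?_, ?_⟩
  · induction α generalizing w with
    | nil => exact ⟨[], w, .nil, h, rfl⟩
    | cons X α ih =>
      cases h with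
      | cons hp hγ hβ =>
        obtain ⟨u, v, hu, hv, rfl⟩ := ih hβ
        exact ⟨_, v, .cons hp hγ hu, hv, by simp⟩
  · rintro ⟨u, v, hu, hv, rfl⟩
    exact hu.append hv

theorem yields_cons_iff {X : G.NT} {β : List G.NT} {w : List T} :
    G.Yields (X :: β) w ↔ ∃ u v, G.Yields [X] u ∧ G.Yields β v ∧ w = u ++ v :=
  yields_append_iff (α := [X])

theorem yields_nil_iff {w : List T} : G.Yields [] w ↔ w = [] := by
  refine ⟨fun h => ?_, ?_⟩
  · cases h; rfl
  · rintro rfl; exact .nil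

theorem yields_singleton_iff {X : G.NT} {w : List T} :
    G.Yields [X] w ↔ ∃ a γ u, (X, a, γ) ∈ G.productions ∧ G.Yields γ u ∧ w = a :: u := by
  refine ⟨fun h => ?_, ?_⟩
  · cases h with
    | cons hp hγ hβ =>
      cases hβ
      exact ⟨_, _, _, hp, hγ, by simp⟩
  · rintro ⟨a, γ, u, hp, hu, rfl⟩
    simpa using Yields.cons hp hu .nil

/-- Words yielded by a grammar belong to every family of languages closed under productions. -/
theorem Yields.mem_prod {α : List G.NT} {w : List T} (h : G.Yields α w) (K : G.NT → Language T)
    (hK : ∀ X a γ, (X, a, γ) ∈ G.productions → ∀ u ∈ (γ.map K).prod, a :: u ∈ K X) :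
    w ∈ (α.map K).prod := by
  induction h with
  | nil => exact Language.nil_mem_one
  | cons hp _ _ ihγ ihβ =>
    rw [List.map_cons, List.prod_cons]
    exact Language.append_mem_mul (hK _ _ _ hp _ ihγ) ihβ

theorem Yields.mem {X : G.NT} {w : List T} (h : G.Yields [X] w) (K : G.NT → Language T)
    (hK : ∀ X a γ, (X, a, γ) ∈ G.productions → ∀ u ∈ (γ.map K).prod, a :: u ∈ K X) : w ∈ K X := by
  simpa using h.mem_prod K hK

theorem Yields.derives_append {α : List G.NT} {u : List T} (h : G.Yields α u) {β δ : List G.NT}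
    {v : List T} (hβ : G.Derives β v δ) : G.Derives (α ++ β) (u ++ v) δ := by
  induction h generalizing β v with
  | nil => exact hβ
  | cons hp _ _ ihγ ihβ =>
    refine .production hp ?_
    simpa using ihγ (ihβ hβ)

theorem Yields.derives {α : List G.NT} {w : List T} (h : G.Yields α w) : G.Derives α w [] := by
  simpa using h.derives_append (.refl [])

/-- Every derivation can be reordered into a leftmost one. -/
theorem Derives.exists_perm_yields {α δ : List G.NT} {w : List T} (h : G.Derives α w δ)
    (hδ : δ = []) : ∃ w', w'.Perm w ∧ G.Yields α w' := by
  induction h with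
  | refl α => subst hδ; exact ⟨[], .refl _, .nil⟩
  | production hp _ ih =>
    obtain ⟨w', hw, hy⟩ := ih hδ
    obtain ⟨u, v, hu, hv, rfl⟩ := yields_append_iff.1 hy
    exact ⟨_, hw.cons _, .cons hp hu hv⟩
  | @swap X Y _ _ _ _ _ _ ih =>
    obtain ⟨w', hw, hy⟩ := ih hδ
    obtain ⟨u, v, hu, hv, rfl⟩ := yields_append_iff.1 hy
    obtain ⟨y, v', hY, hv', rfl⟩ := yields_cons_iff.1 hv
    obtain ⟨x, z, hX, hβ, rfl⟩ := yields_cons_iff.1 hv'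
    -- Undoing the swap exchanges the adjacent factors yielded by `X` and `Y`.
    refine ⟨u ++ (x ++ (y ++ z)), .trans ?_ hw, hu.append (hX.append (hY.append hβ))⟩
    simp only [← List.append_assoc]
    refine List.Perm.append_right _ ?_
    simp only [List.append_assoc]
    exact List.perm_append_comm.append_left _

/-! ### Contexts and pumping -/

/-- `G.Context X Y u v`: every word yielded by `Y` gives a word yielded by `X` when it is put
between `u` and `v`. -/
def Context (G : Grammar T) (X Y : G.NT) (u v : List T) : Prop :=
  ∀ x, G.Yields [Y] x → G.Yields [X] (u ++ x ++ v)

theorem Context.refl (X : G.NT) : G.Context X X [] [] := fun x hx => by simpa using hx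

theorem Context.trans {X Y Z : G.NT} {u v u' v' : List T} (h : G.Context X Y u v)
    (h' : G.Context Y Z u' v') : G.Context X Z (u ++ u') (v' ++ v) := fun x hx => by
  simpa using h _ (h' x hx)

/-- Pigeonhole: at most `r` non-terminals share more than `r * b` letters, so one of them yields
more than `b`. -/
theorem exists_long_factor {α : List G.NT} {w : List T} (h : G.Yields α w) {r b : ℕ}
    (hα : α.length ≤ r) (hw : r * b < w.length) :
    ∃ Z, ∃ u x v, b < x.length ∧ G.Yields [Z] x ∧ w = u ++ x ++ v ∧
      ∀ x', G.Yields [Z] x' → G.Yields α (u ++ x' ++ v) := by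
  induction α generalizing w r with
  | nil => rw [yields_nil_iff] at h; simp [h] at hw
  | cons X α ih =>
    obtain ⟨x, v, hx, hv, rfl⟩ := yields_cons_iff.1 h
    by_cases hb : b < x.length
    · exact ⟨X, [], x, v, hb, hx, by simp, fun x' hx' => by simpa using hx'.append hv⟩
    · obtain _ | r := r
      · simp at hα
      · obtain ⟨Z, u, y, v', hy, hZ, rfl, hc⟩ := ih hv (r := r) (by simpa using hα) (by
          rw [List.length_append] at hw; rw [add_mul, one_mul] at hw; omega)
        refine ⟨Z, x ++ u, y, v', hy, hZ, by simp, fun x' hx' => ?_⟩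
        simpa using hx.append (hc x' hx')

theorem exists_production_length_le (G : Grammar T) :
    ∃ r, ∀ X a γ, (X, a, γ) ∈ G.productions → γ.length ≤ r := by
  obtain ⟨r, hr⟩ := (G.finite_productions.image fun p => p.2.2.length).bddAbove
  exact ⟨r, fun X a γ h => hr ⟨_, h, rfl⟩⟩

/-- A long word either leads back to one of the non-terminals in `S`, or can be pumped. -/
theorem exists_return_or_loop (G : Grammar T) (k : ℕ) : ∃ b : ℕ, ∀ S : Set G.NT, Sᶜ.ncard ≤ k →
    ∀ X w, G.Yields [X] w → b < w.length →
      (∃ Y ∈ S, ∃ u x v, G.Context X Y u v ∧ G.Yields [Y] x ∧ w = u ++ x ++ v) ∨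
      ∃ Y u₁ u x v v₁, G.Context X Y u₁ v₁ ∧ G.Context Y Y u v ∧ u ≠ [] ∧ G.Yields [Y] x ∧
        w = u₁ ++ (u ++ x ++ v) ++ v₁ := by
  have := G.finite_NT
  obtain ⟨r, hr⟩ := G.exists_production_length_le
  induction k with
  | zero =>
    refine ⟨0, fun S hS X w hw _ => .inl ⟨X, ?_, [], w, [], .refl X, hw, by simp⟩⟩
    -- For `k = 0` the set `S` contains every non-terminal, so `X` itself is the return.
    by_contra hX
    exact Set.ncard_ne_zero_of_mem (s := Sᶜ) hX (Set.toFinite _) (Nat.le_zero.1 hS)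
  | succ k ih =>
    obtain ⟨b, hb⟩ := ih
    -- The production at `X` emits one letter, and the remaining more than `r * b` letters come from
    -- at most `r` non-terminals.
    refine ⟨r * b + 1, fun S hS X w hw hlen => ?_⟩
    by_cases hX : X ∈ S
    · exact .inl ⟨X, hX, [], w, [], .refl X, hw, by simp⟩
    obtain ⟨a, γ, w, hp, hγ, rfl⟩ := yields_singleton_iff.1 hw
    obtain ⟨Z, u, x, v, hx, hZ, rfl, hc⟩ :=
      exists_long_factor hγ (hr _ _ _ hp) (by simpa using hlen)
    have hXZ : G.Context X Z (a :: u) v := fun x' hx' =>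
      yields_singleton_iff.2 ⟨a, γ, _, hp, hc x' hx', rfl⟩
    have hcard : (insert X S)ᶜ.ncard ≤ k := by
      have : (insert X S)ᶜ ⊂ Sᶜ := compl_lt_compl_iff_lt.2 (Set.ssubset_insert hX)
      have := Set.ncard_lt_ncard this
      omega
    -- Here `S` grows by the non-terminal just visited. A return to `X` closes a loop, whose left
    -- part is nonempty because it starts with the letter `a`; any other return is already one to
    -- `S`.
    obtain ⟨Y, hY, u', x', v', hZY, hx', rfl⟩ | ⟨Y, u₁, u', x', v', v₁, hZY, hYY, hu, hx', rfl⟩ :=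
      hb _ hcard Z x hZ hx
    · obtain rfl | hY := hY
      · exact .inr ⟨Y, [], a :: u ++ u', x', v' ++ v, [], .refl Y, hXZ.trans hZY, by simp, hx',
          by simp⟩
      · exact .inl ⟨Y, hY, a :: u ++ u', x', v' ++ v, hXZ.trans hZY, hx', by simp⟩
    · exact .inr ⟨Y, a :: u ++ u₁, u', x', v', v₁ ++ v, hXZ.trans hZY, hYY, hu, hx', by simp⟩

/-- The pumping lemma for leftmost derivations. -/
theorem exists_pumping (G : Grammar T) : ∃ b : ℕ, ∀ X w, G.Yields [X] w → b < w.length →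
    ∃ u₁ u x v v₁, u ≠ [] ∧ w = u₁ ++ u ++ x ++ v ++ v₁ ∧
      G.Yields [X] (u₁ ++ (u ++ u) ++ x ++ (v ++ v) ++ v₁) := by
  obtain ⟨b, hb⟩ := G.exists_return_or_loop (∅ : Set G.NT)ᶜ.ncard
  refine ⟨b, fun X w hw hlen => ?_⟩
  obtain ⟨Y, hY, -⟩ | ⟨Y, u₁, u, x, v, v₁, hXY, hYY, hu, hx, rfl⟩ := hb ∅ le_rfl X w hw hlen
  · exact hY.elim
  · exact ⟨u₁, u, x, v, v₁, hu, by simp, by simpa using hXY _ (hYY _ (hYY _ hx))⟩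

end Grammar

/-! ### A criterion for sorted languages -/

/-- Each letter of the first copy of `u` precedes each letter of the second, so any two letters of
`u` compare both ways. -/
theorem exists_eq_of_pairwise_append_self {T : Type} {f : T → ℕ} (hf : f.Injective) {u : List T}
    (h : (u ++ u).Pairwise fun p q => f p ≤ f q) {p q : T} (hp : p ∈ u) (hq : q ∈ u) : p = q := by
  rw [List.pairwise_append] at h
  exact hf (le_antisymm (h.2.2 p hp q hq) (h.2.2 q hq p hp))

/-- A language of arbitrarily long sorted words, in which each of three letters determines the word
by the number of its occurrences, is not partially-commutative context-free. -/
theorem not_mem_PCCFL_of_sorted {T : Type} [DecidableEq T] {L : Language T} {f : T → ℕ}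
    (hf : f.Injective) (hsorted : ∀ w ∈ L, w.Pairwise fun p q => f p ≤ f q)
    {x y z : T} (hxy : x ≠ y) (hxz : x ≠ z) (hyz : y ≠ z)
    (hcount : ∀ w ∈ L, ∀ w' ∈ L, ∀ t, t = x ∨ t = y ∨ t = z → w.count t = w'.count t → w = w')
    (hlong : ∀ n, ∃ w ∈ L, n < w.length) : L ∉ PCCFL T := by
  rintro ⟨G, rfl⟩
  obtain ⟨b, hb⟩ := G.exists_pumping
  obtain ⟨w, hw, hlen⟩ := hlong b
  obtain ⟨w', hperm, hy⟩ := Grammar.Derives.exists_perm_yields hw rfl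
  obtain ⟨u₁, u, m, v, v₁, hu, rfl, hpump⟩ := hb _ _ hy (by rwa [hperm.length_eq])
  have hw' : u₁ ++ u ++ m ++ v ++ v₁ ∈ G.language := hy.derives
  have hpump' : u₁ ++ (u ++ u) ++ m ++ (v ++ v) ++ v₁ ∈ G.language := hpump.derives
  have hs := hsorted _ hpump'
  have huu : (u ++ u).Pairwise fun p q => f p ≤ f q := hs.sublist (by
    simp only [List.append_assoc]
    exact .trans (by rw [← List.append_assoc]; exact List.sublist_append_left _ _)
      (List.sublist_append_right _ _))
  have hvv : (v ++ v).Pairwise fun p q => f p ≤ f q := hs.sublist (by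
    rw [List.append_assoc]
    exact .trans (List.sublist_append_left _ _) (List.sublist_append_right _ _))
  have hne : u₁ ++ u ++ m ++ v ++ v₁ ≠ u₁ ++ (u ++ u) ++ m ++ (v ++ v) ++ v₁ := fun h => by
    have := congrArg List.length h
    have := List.length_pos_iff.2 hu
    simp only [List.length_append] at *
    omega
  -- A letter missing from `u` and `v` keeps its count under pumping, which would make the two words
  -- equal.
  have key : ∀ t, t = x ∨ t = y ∨ t = z → t ∈ u ∨ t ∈ v := fun t ht => by
    by_contra! hmem
    refine hne (hcount _ hw' _ hpump' t ht ?_)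
    simp [List.count_eq_zero_of_not_mem hmem.1, List.count_eq_zero_of_not_mem hmem.2]
  have hu' : ∀ {p q}, p ∈ u → q ∈ u → p = q := exists_eq_of_pairwise_append_self hf huu
  have hv' : ∀ {p q}, p ∈ v → q ∈ v → p = q := exists_eq_of_pairwise_append_self hf hvv
  -- Two of the three letters fall into the same one of `u`, `v`, which has only one letter.
  rcases key x (by simp) with hx | hx <;> rcases key y (by simp) with hy | hy <;>
    rcases key z (by simp) with hz | hz
  all_goals first
    | exact hxy (hu' hx hy)
    | exact hxy (hv' hx hy)
    | exact hxz (hu' hx hz)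
    | exact hxz (hv' hx hz)
    | exact hyz (hu' hy hz)
    | exact hyz (hv' hy hz)


/-! ### Equal numbers of occurrences -/

/-- `S` starts a new round of `a`, `b`, `c` with the letter `t`; the other letters of the round are
left as non-terminals. The non-terminal `none` is `S`, and `some t` emits `t`. -/
inductive EqualCountsProduction : Option ABC → ABC → List (Option ABC) → Prop
  | round {t p q : ABC} : [t, p, q].Perm [.a, .b, .c] →
      EqualCountsProduction none t [none, some p, some q]
  | last {t p q : ABC} : [t, p, q].Perm [.a, .b, .c] →
      EqualCountsProduction none t [some p, some q]
  | letter (t : ABC) : EqualCountsProduction (some t) t []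

instance : Finite ABC :=
  Finite.of_injective (fun t => match t with | .a => (0 : Fin 3) | .b => 1 | .c => 2) fun p q h => by
    cases p <;> cases q <;> simp_all

/-- A commutative grammar for the words with equally many occurrences of each letter. -/
def equalCountsGrammar : Grammar ABC where
  NT := Option ABC
  finite_NT := inferInstance
  initial := none
  productions := {p | EqualCountsProduction p.1 p.2.1 p.2.2}
  finite_productions := by
    have h : {γ : List (Option ABC) | γ.length ≤ 3}.Finite := List.finite_length_le _ 3
    refine ((Set.finite_univ (α := Option ABC)).prod
      ((Set.finite_univ (α := ABC)).prod h)).subset ?_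
    rintro ⟨X, t, γ⟩ (hp : EqualCountsProduction X t γ)
    refine ⟨trivial, trivial, ?_⟩
    cases hp <;> simp
  Indep X Y := X ≠ Y
  indep_symm _ _ := Ne.symm
  indep_irrefl _ h := h rfl

namespace Grammar

/-- Adjacent distinct non-terminals may be swapped, and exchanging equal ones changes nothing. The
prefix `π` lets the induction reach swaps inside a configuration. -/
theorem Derives.of_perm {T : Type} {G : Grammar T} (hG : ∀ X Y, X ≠ Y → G.Indep X Y)
    {α β δ : List G.NT} (hαβ : α.Perm β) {w : List T} (h : G.Derives β w δ) : G.Derives α w δ := by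
  suffices H : ∀ π, G.Derives (π ++ β) w δ → G.Derives (π ++ α) w δ from H [] h
  clear h
  induction hαβ with
  | nil => exact fun _ => id
  | cons X _ ih => exact fun π h => by simpa using ih (π ++ [X]) (by simpa using h)
  | swap X Y l =>
    intro π h
    by_cases hXY : Y = X
    · rwa [hXY] at h ⊢
    · exact .swap (hG _ _ hXY) h
  | trans _ _ ih₁ ih₂ => exact fun π h => ih₁ π (ih₂ π h)

end Grammar

theorem count_abc {l : List ABC} (h : l.Perm [.a, .b, .c]) (t : ABC) : l.count t = 1 := by
  rw [h.count_eq]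
  cases t <;> rfl

theorem exists_round (t : ABC) : ∃ p q, [t, p, q].Perm [ABC.a, .b, .c] := by
  cases t
  · exact ⟨.b, .c, by decide⟩
  · exact ⟨.a, .c, by decide⟩
  · exact ⟨.a, .b, by decide⟩

theorem derives_letters {α : List (Option ABC)} {w : List ABC} (h : α.Perm (w.map some)) :
    equalCountsGrammar.Derives α w [] := by
  refine .of_perm (fun _ _ => id) h ?_
  clear h
  induction w with
  | nil => exact .refl _
  | cons t w ih => exact .production (.letter t) ih

/-- Greedy strategy: each of the first `n + 1` letters of `w` opens a round, even if the same letter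
is already pending in `l`. The counts ensure that the rest of `w` is then a permutation of the
pending letters. -/
theorem derives_rounds (n : ℕ) (l w : List ABC) (h : ∀ t, w.count t = l.count t + (n + 1)) :
    equalCountsGrammar.Derives (none :: l.map some) w [] := by
  induction n generalizing l w with
  | zero =>
    obtain _ | ⟨t, w⟩ := w
    · simpa using h .a
    obtain ⟨p, q, ht⟩ := exists_round t
    refine .production (.last ht) (derives_letters (?_ : List.Perm ([p, q] ++ l |>.map some) _))
    refine List.Perm.map _ ((List.perm_cons t).1 (List.perm_iff_count.2 fun r => ?_))
    have := count_abc ht r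
    have := h r
    simp only [List.count_cons, List.count_append, List.count_nil] at *
    omega
  | succ n ih =>
    obtain _ | ⟨t, w⟩ := w
    · simpa using h .a
    obtain ⟨p, q, ht⟩ := exists_round t
    refine .production (.round ht) (ih (p :: q :: l) w fun r => ?_)
    have := count_abc ht r
    have := h r
    simp only [List.count_cons, List.count_nil] at *
    omega

theorem count_eq_of_yields {w : List ABC} (h : equalCountsGrammar.Yields [none] w) :
    ∃ n, 1 ≤ n ∧ ∀ t, w.count t = n := by
  let K : Option ABC → Language ABC
    | none => {w | ∃ n, 1 ≤ n ∧ ∀ t, w.count t = n}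
    | some t => {[t]}
  refine h.mem K ?_
  rintro X t γ (hp : EqualCountsProduction X t γ) u hu
  cases hp with
  | @round t p q ht =>
    obtain ⟨v, ⟨n, hn, hv⟩, _, ⟨_, rfl, _, ⟨_, rfl, _, rfl, rfl⟩, rfl⟩, rfl⟩ := hu
    refine ⟨n + 1, by omega, fun r => ?_⟩
    have := count_abc ht r
    have := hv r
    simp only [List.count_cons, List.count_append, List.count_nil] at *
    omega
  | @last t p q ht =>
    obtain ⟨_, rfl, _, ⟨_, rfl, _, rfl, rfl⟩, rfl⟩ := hu
    exact ⟨1, le_rfl, count_abc ht⟩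
  | letter t =>
    obtain rfl : u = [] := hu
    rfl

theorem language_equalCountsGrammar : equalCountsGrammar.language = equalCounts := by
  ext w
  constructor
  · intro h
    obtain ⟨w', hw, hy⟩ := Grammar.Derives.exists_perm_yields h rfl
    obtain ⟨n, hn, h⟩ := count_eq_of_yields hy
    simp only [hw.count_eq] at h
    refine ⟨?_, by rw [h, h], by rw [h, h]⟩
    rintro rfl
    have := h .a
    rw [List.count_nil] at this
    omega
  · rintro ⟨hne, hab, hbc⟩
    have hw : ∀ t, w.count t = w.count .a := by
      intro t; cases t <;> omega
    obtain ⟨n, hn⟩ : ∃ n, w.count .a = n + 1 := by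
      obtain ⟨t, ht⟩ := List.exists_mem_of_ne_nil w hne
      exact Nat.exists_eq_succ_of_ne_zero (by rw [← hw t]; exact (List.count_pos_iff.2 ht).ne')
    exact derives_rounds n [] w fun t => by simp [hw t, hn]

theorem equalCounts_mem_CCFL : equalCounts ∈ CCFL ABC :=
  ⟨equalCountsGrammar, fun _ _ => id, language_equalCountsGrammar⟩

/-- In a commutative grammar, dependence implies equality and is therefore transitive. -/
theorem CCFL_subset_TrPCCFL (T : Type) : CCFL T ⊆ TrPCCFL T := by
  rintro L ⟨G, hG, rfl⟩
  have hdep : ∀ X Y, G.Dep X Y → X = Y := fun X Y h => by_contra fun hXY => h (hG X Y hXY)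
  exact ⟨G, fun X Y Z hXY hYZ => by rwa [hdep X Y hXY], rfl⟩

theorem TrPCCFL_subset_PCCFL (T : Type) : TrPCCFL T ⊆ PCCFL T := by
  rintro L ⟨G, -, hL⟩
  exact ⟨G, hL⟩

/-! ### The regular language `a* b* c*` -/

/-- An automaton for `a* b* c*`; its states are the least letter still allowed, and a sink. -/
def sortedDFA : DFA ABC (Fin 4) where
  step
    | 0, .a => 0
    | 0, .b => 1
    | 1, .b => 1
    | 0, .c => 2
    | 1, .c => 2
    | 2, .c => 2
    | _, _ => 3
  start := 0
  accept := {q | q ≠ 3}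

open Computability in
theorem mem_kstar_singleton {T : Type} {t : T} {w : List T} :
    w ∈ ({[t]} : Language T)∗ ↔ ∃ n, w = List.replicate n t := by
  rw [Language.mem_kstar]
  constructor
  · rintro ⟨l, rfl, h⟩
    refine ⟨l.length, ?_⟩
    induction l with
    | nil => rfl
    | cons x l ih =>
      obtain rfl : x = [t] := h x (by simp)
      simp [List.replicate_succ, ih fun y hy => h y (by simp [hy])]
  · rintro ⟨n, rfl⟩
    refine ⟨List.replicate n [t], by simp, fun y hy => ?_⟩
    exact (List.eq_of_mem_replicate hy)

theorem mem_aStarBStarCStar {w : List ABC} : w ∈ aStarBStarCStar ↔ ∃ i j k,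
    w = List.replicate i ABC.a ++ List.replicate j ABC.b ++ List.replicate k ABC.c := by
  simp only [aStarBStarCStar, Language.mem_mul, mem_kstar_singleton]
  constructor
  · rintro ⟨_, ⟨_, ⟨i, rfl⟩, _, ⟨j, rfl⟩, rfl⟩, _, ⟨k, rfl⟩, rfl⟩
    exact ⟨i, j, k, rfl⟩
  · rintro ⟨i, j, k, rfl⟩
    exact ⟨_, ⟨_, ⟨i, rfl⟩, _, ⟨j, rfl⟩, rfl⟩, _, ⟨k, rfl⟩, rfl⟩

theorem evalFrom_sink (w : List ABC) : sortedDFA.evalFrom 3 w = 3 := by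
  induction w with
  | nil => rfl
  | cons t w ih => rw [DFA.evalFrom_cons]; cases t <;> exact ih

open Computability in
-- The unfolding `{s}∗ K = K + {s} {s}∗ K`, read on the first letter; it matches one step of the
-- automaton.
theorem cons_mem_kstar_singleton_mul {T : Type} {s t : T} {w : List T} {K : Language T} :
    t :: w ∈ ({[s]} : Language T)∗ * K ↔ t = s ∧ w ∈ ({[s]} : Language T)∗ * K ∨ t :: w ∈ K := by
  conv_lhs => rw [← Language.one_add_self_mul_kstar_eq_kstar, add_mul, one_mul, mul_assoc]
  rw [Language.mem_add, or_comm, Language.mem_mul (l := {[s]})]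
  refine or_congr_left ⟨?_, ?_⟩
  · rintro ⟨_, rfl, v, hv, h⟩
    cases h
    exact ⟨rfl, hv⟩
  · rintro ⟨rfl, h⟩
    exact ⟨_, rfl, w, h, rfl⟩

open Computability in
theorem nil_mem_kstar_mul {T : Type} {K M : Language T} (h : [] ∈ M) : [] ∈ K∗ * M :=
  Language.append_mem_mul (Language.nil_mem_kstar K) h

open Computability in
theorem isRegular_aStarBStarCStar : aStarBStarCStar.IsRegular := by
  refine ⟨Fin 4, inferInstance, sortedDFA, ?_⟩
  -- The residual language of each state is found backwards from the last block. The factor `1`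
  -- gives this block the same shape as the others.
  have h₂ (w) : w ∈ ({[.c]} : Language ABC)∗ * 1 ↔ sortedDFA.evalFrom 2 w ≠ 3 := by
    induction w with
    | nil => exact iff_of_true (nil_mem_kstar_mul Language.nil_mem_one) (by decide)
    | cons t w ih =>
      rw [cons_mem_kstar_singleton_mul, ih, DFA.evalFrom_cons]
      cases t <;> simp [sortedDFA, Language.mem_one] <;> exact evalFrom_sink w
  have h₁ (w) : w ∈ ({[.b]} : Language ABC)∗ * (({[.c]} : Language ABC)∗ * 1) ↔
      sortedDFA.evalFrom 1 w ≠ 3 := by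
    induction w with
    | nil =>
      exact iff_of_true (nil_mem_kstar_mul (nil_mem_kstar_mul Language.nil_mem_one)) (by decide)
    | cons t w ih =>
      rw [cons_mem_kstar_singleton_mul, ih, h₂, DFA.evalFrom_cons, DFA.evalFrom_cons]
      cases t <;> simp [sortedDFA]
      exact fun h => absurd (evalFrom_sink w) h
  have h₀ (w) : w ∈ ({[.a]} : Language ABC)∗ * (({[.b]} : Language ABC)∗ *
      (({[.c]} : Language ABC)∗ * 1)) ↔ sortedDFA.evalFrom 0 w ≠ 3 := by
    induction w with
    | nil =>
      exact iff_of_true (nil_mem_kstar_mul (nil_mem_kstar_mul (nil_mem_kstar_mul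
        Language.nil_mem_one))) (by decide)
    | cons t w ih =>
      rw [cons_mem_kstar_singleton_mul, ih, h₁, DFA.evalFrom_cons, DFA.evalFrom_cons]
      cases t <;> simp [sortedDFA]
      exact fun h => absurd (evalFrom_sink w) h
  ext w
  rw [aStarBStarCStar, mul_assoc, ← mul_one ({[ABC.c]} : Language ABC)∗]
  exact (h₀ w).symm

theorem equalCounts_inf_aStarBStarCStar : equalCounts ⊓ aStarBStarCStar =
    {w | ∃ n : ℕ, 1 ≤ n ∧ w = List.replicate n ABC.a ++ List.replicate n ABC.b ++
      List.replicate n ABC.c} := by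
  ext w
  rw [Language.mem_inf, mem_aStarBStarCStar]
  constructor
  · rintro ⟨⟨hne, hab, hbc⟩, i, j, k, rfl⟩
    simp [List.count_append, List.count_replicate] at hab hbc hne
    subst hab hbc
    exact ⟨i, by omega, rfl⟩
  · rintro ⟨n, hn, rfl⟩
    refine ⟨⟨?_, ?_, ?_⟩, n, n, n, rfl⟩
    · simp; omega
    · simp [List.count_append, List.count_replicate]
    · simp [List.count_append, List.count_replicate]

theorem inf_notMem_PCCFL : equalCounts ⊓ aStarBStarCStar ∉ PCCFL ABC := by
  rw [equalCounts_inf_aStarBStarCStar]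
  refine not_mem_PCCFL_of_sorted (f := fun t => match t with | .a => 0 | .b => 1 | .c => 2)
    (fun p q h => by cases p <;> cases q <;> simp_all) ?_
    (x := .a) (y := .b) (z := .c) (by simp) (by simp) (by simp) ?_ fun n => ?_
  · rintro _ ⟨n, -, rfl⟩
    simp [List.pairwise_append, List.pairwise_replicate, List.mem_replicate]
  · rintro _ ⟨n, -, rfl⟩ _ ⟨m, -, rfl⟩ t (rfl | rfl | rfl) h <;>
    · simp [List.count_append, List.count_replicate] at h
      rw [h]
  · exact ⟨_, ⟨n + 1, by omega, rfl⟩, by simp; omega⟩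


/-! ### Closure under shuffle -/

namespace Grammar

variable {T : Type}

theorem derives_singleton_iff {G : Grammar T} {X : G.NT} {w : List T} :
    G.Derives [X] w [] ↔
      ∃ a γ u, (X, a, γ) ∈ G.productions ∧ G.Derives γ u [] ∧ w = a :: u := by
  constructor
  · intro h
    generalize hα : [X] = α at h
    cases h with
    | refl => simp at hα
    | production hp h =>
      cases hα
      exact ⟨_, _, _, hp, by simpa using h, rfl⟩
    | swap => exact absurd (congrArg List.length hα) (by simp; omega)
  · rintro ⟨a, γ, u, hp, hu, rfl⟩
    exact .production hp (by simpa using hu)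

theorem Derives.move {G : Grammar T} {X : G.NT} {π β ρ δ : List G.NT} {w : List T}
    (h : ∀ Y ∈ β, G.Indep X Y) (hd : G.Derives (π ++ (β ++ X :: ρ)) w δ) :
    G.Derives (π ++ X :: (β ++ ρ)) w δ := by
  induction β generalizing π with
  | nil => exact hd
  | cons Y β ih =>
    refine .swap (h Y (by simp)) ?_
    simpa using ih (π := π ++ [Y]) (fun Z hZ => h Z (by simp [hZ])) (by simpa using hd)

/-- Moves a block past an independent block, one non-terminal at a time. -/
theorem Derives.exchange {G : Grammar T} {π α β ρ δ : List G.NT} {w : List T}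
    (h : ∀ X ∈ α, ∀ Y ∈ β, G.Indep X Y) (hd : G.Derives (π ++ (β ++ (α ++ ρ))) w δ) :
    G.Derives (π ++ (α ++ (β ++ ρ))) w δ := by
  induction α generalizing π with
  | nil => exact hd
  | cons X α ih =>
    have := Derives.move (h X (by simp)) (ρ := α ++ ρ) (by simpa using hd)
    simpa using ih (π := π ++ [X]) (fun Z hZ => h Z (by simp [hZ])) (by simpa using this)

/-- The productions of the shuffle of two grammars. The initial non-terminal `none` starts either
of the grammars and leaves the initial non-terminal of the other one. -/
inductive ShuffleProduction (G₁ G₂ : Grammar T) :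
    Option (G₁.NT ⊕ G₂.NT) → T → List (Option (G₁.NT ⊕ G₂.NT)) → Prop
  | start_left {a : T} {γ : List G₁.NT} : (G₁.initial, a, γ) ∈ G₁.productions →
      ShuffleProduction G₁ G₂ none a
        (γ.map (fun X => some (.inl X)) ++ [G₂.initial].map (fun Y => some (.inr Y)))
  | start_right {a : T} {γ : List G₂.NT} : (G₂.initial, a, γ) ∈ G₂.productions →
      ShuffleProduction G₁ G₂ none a
        ([G₁.initial].map (fun X => some (.inl X)) ++ γ.map (fun Y => some (.inr Y)))
  | left {X : G₁.NT} {a : T} {γ : List G₁.NT} : (X, a, γ) ∈ G₁.productions →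
      ShuffleProduction G₁ G₂ (some (.inl X)) a (γ.map fun X => some (.inl X))
  | right {Y : G₂.NT} {a : T} {γ : List G₂.NT} : (Y, a, γ) ∈ G₂.productions →
      ShuffleProduction G₁ G₂ (some (.inr Y)) a (γ.map fun Y => some (.inr Y))

/-- In the shuffle of two grammars, non-terminals of different grammars are independent. -/
def ShuffleIndep (G₁ G₂ : Grammar T) : Option (G₁.NT ⊕ G₂.NT) → Option (G₁.NT ⊕ G₂.NT) → Prop
  | some (.inl X), some (.inl Y) => G₁.Indep X Y
  | some (.inr X), some (.inr Y) => G₂.Indep X Y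
  | none, none => False
  | _, _ => True

/-- A grammar for the shuffle of the languages of two grammars. -/
abbrev shuffle (G₁ G₂ : Grammar T) : Grammar T where
  NT := Option (G₁.NT ⊕ G₂.NT)
  finite_NT := by
    have := G₁.finite_NT
    have := G₂.finite_NT
    infer_instance
  initial := none
  productions := {p | ShuffleProduction G₁ G₂ p.1 p.2.1 p.2.2}
  finite_productions := by
    have h₁ := G₁.finite_productions
    have h₂ := G₂.finite_productions
    refine ((((h₁.image fun p => ((none : Option (G₁.NT ⊕ G₂.NT)), p.2.1,
      p.2.2.map (fun X => some (.inl X)) ++ [G₂.initial].map (fun Y => some (.inr Y)))).union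
      (h₂.image fun p => (none, p.2.1,
        [G₁.initial].map (fun X => some (.inl X)) ++ p.2.2.map (fun Y => some (.inr Y))))).union
      (h₁.image fun p => (some (.inl p.1), p.2.1, p.2.2.map fun X => some (.inl X)))).union
      (h₂.image fun p => (some (.inr p.1), p.2.1, p.2.2.map fun X => some (.inr X)))).subset ?_
    rintro ⟨X, a, γ⟩ (hp : ShuffleProduction G₁ G₂ X a γ)
    cases hp with
    | start_left hp => exact .inl (.inl (.inl ⟨_, hp, rfl⟩))
    | start_right hp => exact .inl (.inl (.inr ⟨_, hp, rfl⟩))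
    | left hp => exact .inl (.inr ⟨_, hp, rfl⟩)
    | right hp => exact .inr ⟨_, hp, rfl⟩
  Indep := ShuffleIndep G₁ G₂
  indep_symm := by
    rintro (_ | X | X) (_ | Y | Y) h
    all_goals first
      | exact h
      | exact G₁.indep_symm _ _ h
      | exact G₂.indep_symm _ _ h
  indep_irrefl := by
    rintro (_ | X | X) h
    exacts [h, G₁.indep_irrefl X h, G₂.indep_irrefl X h]

variable {G₁ G₂ : Grammar T}

/-- The non-terminals of the first grammar in a configuration of the shuffle. -/
abbrev projLeft (δ : List (Option (G₁.NT ⊕ G₂.NT))) : List G₁.NT :=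
  δ.filterMap fun
    | some (.inl X) => some X
    | _ => none

/-- The non-terminals of the second grammar in a configuration of the shuffle. -/
abbrev projRight (δ : List (Option (G₁.NT ⊕ G₂.NT))) : List G₂.NT :=
  δ.filterMap fun
    | some (.inr X) => some X
    | _ => none

/-- Project each step onto the two grammars: a production acts on one side only, and a swap across
the sides is invisible to both. The symbol `none` occurs in no right-hand side, so its absence
persists. -/
theorem Derives.exists_interleaving {δ ε : List (shuffle G₁ G₂).NT} {w : List T}
    (h : (shuffle G₁ G₂).Derives δ w ε) (hε : ε = []) (hδ : none ∉ δ) :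
    ∃ w₁ w₂, Interleaving w₁ w₂ w ∧ G₁.Derives (projLeft δ) w₁ [] ∧
      G₂.Derives (projRight δ) w₂ [] := by
  induction h with
  | refl δ => subst hε; exact ⟨[], [], .nil, .refl _, .refl _⟩
  | @production X a γ β _ _ hp _ ih =>
    replace hp : ShuffleProduction G₁ G₂ X a γ := hp
    cases hp with
    | start_left => simp at hδ
    | start_right => simp at hδ
    | left hp =>
      obtain ⟨w₁, w₂, hw, h₁, h₂⟩ := ih hε (by simpa using hδ)
      refine ⟨_, _, hw.left a, .production hp ?_, ?_⟩
      · simpa [Function.comp_def] using h₁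
      · simpa [Function.comp_def] using h₂
    | right hp =>
      obtain ⟨w₁, w₂, hw, h₁, h₂⟩ := ih hε (by simpa using hδ)
      refine ⟨_, _, hw.right a, ?_, .production hp ?_⟩
      · simpa [Function.comp_def] using h₁
      · simpa [Function.comp_def] using h₂
  | @swap X Y α β _ _ hXY _ ih =>
    obtain ⟨w₁, w₂, hw, h₁, h₂⟩ := ih hε (by simp at hδ ⊢; tauto)
    refine ⟨w₁, w₂, hw, ?_, ?_⟩
    · rcases X with _ | X | X <;> rcases Y with _ | Y | Y <;> simp at h₁ ⊢
      all_goals first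
        | exact h₁
        | exact .swap hXY h₁
    · rcases X with _ | X | X <;> rcases Y with _ | Y | Y <;> simp at h₂ ⊢
      all_goals first
        | exact h₂
        | exact .swap hXY h₂

/-- A configuration of the first grammar, as a configuration of the shuffle. -/
abbrev inl (α : List G₁.NT) : List (shuffle G₁ G₂).NT := α.map fun X => some (.inl X)

/-- A configuration of the second grammar, as a configuration of the shuffle. -/
abbrev inr (β : List G₂.NT) : List (shuffle G₁ G₂).NT := β.map fun Y => some (.inr Y)

theorem indep_of_mem {α : List G₁.NT} {β : List G₂.NT} {X Y : (shuffle G₁ G₂).NT}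
    (hX : X ∈ inl (G₂ := G₂) α) (hY : Y ∈ inr (G₁ := G₁) β) :
    (shuffle G₁ G₂).Indep X Y ∧ (shuffle G₁ G₂).Indep Y X := by
  obtain ⟨X, -, rfl⟩ := List.mem_map.1 hX
  obtain ⟨Y, -, rfl⟩ := List.mem_map.1 hY
  exact ⟨trivial, trivial⟩

/-- The inner induction of `derives_join`, along the derivation of the second grammar. The
hypothesis `hleft` takes over as soon as the next letter comes from `w₁`. -/
theorem derives_join_of_left {α : List G₁.NT} {w₁ : List T} (hnil : w₁ = [] → α = [])
    (hleft : ∀ a u, w₁ = a :: u → ∀ β w₂ w, G₂.Derives β w₂ [] → Interleaving u w₂ w →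
      (shuffle G₁ G₂).Derives (inl α ++ inr β) (a :: w) [])
    {β ε : List G₂.NT} {w₂ w : List T} (h₂ : G₂.Derives β w₂ ε) (hε : ε = [])
    (hw : Interleaving w₁ w₂ w) : (shuffle G₁ G₂).Derives (inl α ++ inr β) w [] := by
  induction h₂ generalizing w with
  | refl β =>
    subst hε
    cases hw with
    | nil => rw [hnil rfl]; exact .refl _
    | left a hw => exact hleft _ _ rfl _ _ _ (.refl _) hw
  | @production Y b γ β _ v hp h ih =>
    subst hε
    cases hw with
    | left a hw => exact hleft _ _ rfl _ _ _ (.production hp h) hw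
    | @right _ _ u _ hw =>
      -- The normal form keeps `inl` before `inr`. To emit `b`, the head `Y` is moved in front of
      -- `inl α`, rewritten to `γ`, and `γ` is moved back.
      have hd : (shuffle G₁ G₂).Derives (inl α ++ (inr γ ++ inr β)) u [] := by
        simpa using ih rfl hw
      have hd' : (shuffle G₁ G₂).Derives (inr γ ++ (inl α ++ inr β)) u [] :=
        hd.exchange (π := []) fun Y hY X hX => (indep_of_mem hX hY).2
      have hd'' : (shuffle G₁ G₂).Derives (inr [Y] ++ (inl α ++ inr β)) (b :: u) [] :=
        .production (.right hp) hd'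
      exact hd''.exchange (π := []) (α := inl α) (β := inr [Y]) fun X hX Y hY => (indep_of_mem hX hY).1
  | @swap Y Z β ρ _ _ hYZ _ ih =>
    have := ih hε hw
    simp only [inl, inr, List.map_append, List.map_cons, ← List.append_assoc] at this ⊢
    exact .swap hYZ this

theorem derives_join {α δ : List G₁.NT} {w₁ : List T} (h₁ : G₁.Derives α w₁ δ) (hδ : δ = [])
    {β : List G₂.NT} {w₂ w : List T} (h₂ : G₂.Derives β w₂ []) (hw : Interleaving w₁ w₂ w) :
    (shuffle G₁ G₂).Derives (inl α ++ inr β) w [] := by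
  induction h₁ generalizing β w₂ w with
  | refl α => exact derives_join_of_left (fun _ => hδ) (by simp) h₂ rfl hw
  | @production X a γ α _ v hp _ ih =>
    refine derives_join_of_left (by simp) ?_ h₂ rfl hw
    rintro _ _ ⟨rfl, rfl⟩ β w₂ w hβ hw
    have hd : (shuffle G₁ G₂).Derives (inl γ ++ (inl α ++ inr β)) w [] := by
      simpa using ih hδ hβ hw
    exact .production (.left hp) hd
  | swap hXY _ ih =>
    have := ih hδ h₂ hw
    simp only [inl, inr, List.map_append, List.map_cons, List.append_assoc, List.cons_append]
      at this ⊢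
    exact .swap hXY this

theorem language_shuffle (G₁ G₂ : Grammar T) :
    (shuffle G₁ G₂).language = PartiallyCommutative.shuffle G₁.language G₂.language := by
  ext w
  constructor
  · intro h
    obtain ⟨a, γ, u, hp, hu, rfl⟩ := derives_singleton_iff.1 h
    replace hp : ShuffleProduction G₁ G₂ none a γ := hp
    cases hp with
    | start_left hp =>
      obtain ⟨w₁, w₂, hw, h₁, h₂⟩ := hu.exists_interleaving rfl (by simp)
      exact ⟨_, derives_singleton_iff.2 ⟨a, _, w₁, hp, by simpa [Function.comp_def] using h₁, rfl⟩,
        w₂, show G₂.Derives _ _ _ by simpa [Function.comp_def] using h₂, hw.left a⟩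
    | start_right hp =>
      obtain ⟨w₁, w₂, hw, h₁, h₂⟩ := hu.exists_interleaving rfl (by simp)
      exact ⟨w₁, show G₁.Derives _ _ _ by simpa [Function.comp_def] using h₁, _,
        derives_singleton_iff.2 ⟨a, _, w₂, hp, by simpa [Function.comp_def] using h₂, rfl⟩,
        hw.right a⟩
  · rintro ⟨w₁, h₁, w₂, h₂, hw⟩
    obtain ⟨a, γ₁, u₁, hp₁, hu₁, rfl⟩ := derives_singleton_iff.1 h₁
    obtain ⟨b, γ₂, u₂, hp₂, hu₂, rfl⟩ := derives_singleton_iff.1 h₂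
    cases hw with
    | left _ hw =>
      exact derives_singleton_iff.2 ⟨a, _, _, .start_left hp₁, derives_join hu₁ rfl h₂ hw, rfl⟩
    | right _ hw =>
      exact derives_singleton_iff.2 ⟨b, _, _, .start_right hp₂, derives_join h₁ rfl hu₂ hw, rfl⟩

end Grammar

/-- Dependence in the shuffle grammar never links the two components, and `none` depends only on
itself, so transitivity is inherited. -/
theorem shuffle_mem_TrPCCFL {T : Type} {L₁ L₂ : Language T} (h₁ : L₁ ∈ TrPCCFL T)
    (h₂ : L₂ ∈ TrPCCFL T) : shuffle L₁ L₂ ∈ TrPCCFL T := by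
  obtain ⟨G₁, h₁, rfl⟩ := h₁
  obtain ⟨G₂, h₂, rfl⟩ := h₂
  refine ⟨G₁.shuffle G₂, ?_, Grammar.language_shuffle G₁ G₂⟩
  rintro (_ | X | X) (_ | Y | Y) (_ | Z | Z) hXY hYZ
  all_goals first
    | exact id
    | exact h₁ X Y Z hXY hYZ
    | exact h₂ X Y Z hXY hYZ
    | exact (hXY trivial).elim
    | exact (hYZ trivial).elim

/-! ### Context-free languages -/

namespace Grammar

variable {T : Type} (G : Grammar T)

theorem derives_nil_iff_yields {G : Grammar T} (hG : ∀ X Y, ¬ G.Indep X Y) {α : List G.NT}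
    {w : List T} : G.Derives α w [] ↔ G.Yields α w := by
  refine ⟨fun h => ?_, Yields.derives⟩
  generalize hδ : [] = δ at h
  induction h with
  | refl α => subst hδ; exact .nil
  | production hp _ ih =>
    obtain ⟨u, v, hu, hv, rfl⟩ := yields_append_iff.1 (ih hδ)
    exact .cons hp hu hv
  | swap h => exact (hG _ _ h).elim

/-- The underlying context-free grammar. -/
noncomputable abbrev toContextFreeGrammar : ContextFreeGrammar T where
  NT := G.NT
  initial := G.initial
  rules := (G.finite_productions.image fun p =>
    (⟨p.1, .terminal p.2.1 :: p.2.2.map .nonterminal⟩ : ContextFreeRule T G.NT)).toFinset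

/-- The words generated by a symbol. -/
def symbolLanguage : Symbol T G.NT → Language T
  | .terminal t => {[t]}
  | .nonterminal X => {w | G.Yields [X] w}

variable {G}

theorem mem_prod_nonterminal {α : List G.NT} {w : List T} :
    w ∈ ((α.map Symbol.nonterminal).map G.symbolLanguage).prod ↔ G.Yields α w := by
  induction α generalizing w with
  | nil => exact yields_nil_iff.symm
  | cons X α ih =>
    rw [yields_cons_iff, List.map_cons, List.map_cons, List.prod_cons, Language.mem_mul]
    constructor
    · rintro ⟨u, hu, v, hv, rfl⟩
      exact ⟨u, v, hu, ih.1 hv, rfl⟩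
    · rintro ⟨u, v, hu, hv, rfl⟩
      exact ⟨u, hu, v, ih.2 hv, rfl⟩

theorem mem_prod_terminal {v w : List T} :
    w ∈ ((v.map Symbol.terminal).map G.symbolLanguage).prod ↔ w = v := by
  induction v generalizing w with
  | nil => exact Iff.rfl
  | cons t v ih =>
    rw [List.map_cons, List.map_cons, List.prod_cons, Language.mem_mul]
    constructor
    · rintro ⟨_, rfl, u, hu, rfl⟩
      rw [ih.1 hu]
      rfl
    · rintro rfl
      exact ⟨[t], rfl, v, ih.2 rfl, rfl⟩

/-- Interpreting a sentential form as the product of the languages of its symbols, a rewriting step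
can only shrink it. A derived terminal word therefore lies in the language of the initial symbol. -/
theorem prod_symbolLanguage_le {s s' : List (Symbol T G.NT)}
    (h : G.toContextFreeGrammar.Derives s s') :
    (s'.map G.symbolLanguage).prod ≤ (s.map G.symbolLanguage).prod := by
  induction h with
  | refl => exact le_rfl
  | tail _ h ih =>
    refine le_trans ?_ ih
    obtain ⟨r, hr, h⟩ := h
    obtain ⟨p, q, rfl, rfl⟩ := h.exists_parts
    obtain ⟨⟨X, a, γ⟩, hp, rfl⟩ := (Set.Finite.mem_toFinset _).1 hr
    simp only [List.map_append, List.prod_append]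
    refine mul_le_mul' (mul_le_mul' le_rfl ?_) le_rfl
    rintro _ ⟨_, rfl, u, hu, rfl⟩
    rw [List.map_singleton, List.prod_singleton]
    exact yields_singleton_iff.2 ⟨a, γ, u, hp, mem_prod_nonterminal.1 hu, rfl⟩

theorem Yields.contextFree_derives {α : List G.NT} {w : List T} (h : G.Yields α w) :
    G.toContextFreeGrammar.Derives (α.map .nonterminal) (w.map .terminal) := by
  induction h with
  | nil => exact .refl _
  | @cons X a γ β u v hp _ _ ihγ ihβ =>
    have hX : G.toContextFreeGrammar.Produces [.nonterminal X]
        (.terminal a :: γ.map .nonterminal) :=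
      ⟨_, (Set.Finite.mem_toFinset _).2 ⟨_, hp, rfl⟩, ContextFreeRule.Rewrites.input_output⟩
    have h₁ := (hX.single.trans (ihγ.append_left [.terminal a])).append_right
      (β.map .nonterminal)
    have h₂ := ihβ.append_left (.terminal a :: u.map .terminal)
    simpa using h₁.trans h₂

theorem isContextFree_setOf_yields (G : Grammar T) :
    Language.IsContextFree ({w | G.Yields [G.initial] w} : Language T) := by
  refine ⟨G.toContextFreeGrammar, ?_⟩
  ext w
  constructor
  · intro h
    have := prod_symbolLanguage_le h (mem_prod_terminal.2 rfl)
    rwa [List.map_singleton, List.prod_singleton] at this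
  · exact Yields.contextFree_derives

theorem isContextFree_language (hG : ∀ X Y, ¬ G.Indep X Y) : G.language.IsContextFree := by
  have : G.language = {w | G.Yields [G.initial] w} := by
    ext w
    exact derives_nil_iff_yields hG
  rw [this]
  exact G.isContextFree_setOf_yields

end Grammar


/-! ### Words with a matching pair of blocks -/

section Blocks

variable {T : Type}

/-- The non-terminals of a grammar for the words `p xⁿ z yⁿ τ` with `n ≥ 1`: an initial one, one for
the words `xⁿ z yⁿ`, and one for each letter. -/
inductive BlockNT (T : Type)
  | start
  | core
  | letter (t : T)

instance [Finite T] : Finite (BlockNT T) := by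
  refine Finite.of_surjective (fun X : Option (Option T) => match X with
    | none => .start
    | some none => .core
    | some (some t) => .letter t) ?_
  rintro (_ | _ | t)
  exacts [⟨none, rfl⟩, ⟨some none, rfl⟩, ⟨some (some t), rfl⟩]

/-- The productions of the grammar for the words `p xⁿ z yⁿ τ` with `n ≥ 1`. -/
inductive BlockProduction (p x z y : T) (τ : List T) :
    BlockNT T → T → List (BlockNT T) → Prop
  | start : BlockProduction p x z y τ .start p (.core :: τ.map .letter)
  | step : BlockProduction p x z y τ .core x [.core, .letter y]
  | turn : BlockProduction p x z y τ .core x [.letter z, .letter y]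
  | letter (t : T) : BlockProduction p x z y τ (.letter t) t []

/-- A grammar for the words `p xⁿ z yⁿ τ` with `n ≥ 1`, without any commutation. -/
def blockGrammar [Finite T] (p x z y : T) (τ : List T) : Grammar T where
  NT := BlockNT T
  finite_NT := inferInstance
  initial := .start
  productions := {q | BlockProduction p x z y τ q.1 q.2.1 q.2.2}
  finite_productions := by
    have h : {γ : List (BlockNT T) | γ.length ≤ τ.length + 2}.Finite := List.finite_length_le _ _
    refine ((Set.finite_univ (α := BlockNT T)).prod
      ((Set.finite_univ (α := T)).prod h)).subset ?_
    rintro ⟨X, t, γ⟩ (hp : BlockProduction p x z y τ X t γ)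
    refine ⟨trivial, trivial, ?_⟩
    cases hp <;> simp
  Indep _ _ := False
  indep_symm _ _ := id
  indep_irrefl _ := id

variable {p x z y : T} {τ : List T}

/-- The words generated by the non-terminals of the grammar for the words `p xⁿ z yⁿ τ`. -/
def blockLanguage (p x z y : T) (τ : List T) : BlockNT T → Language T
  | .start => {w | ∃ n, 1 ≤ n ∧ w = p :: (List.replicate n x ++ z :: List.replicate n y ++ τ)}
  | .core => {w | ∃ n, 1 ≤ n ∧ w = List.replicate n x ++ z :: List.replicate n y}
  | .letter t => {[t]}

theorem mem_prod_letter {u : List T}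
    (h : u ∈ ((τ.map BlockNT.letter).map (blockLanguage p x z y τ)).prod) : u = τ := by
  suffices H : ∀ (σ u : List T),
      u ∈ ((σ.map BlockNT.letter).map (blockLanguage p x z y τ)).prod → u = σ from H _ _ h
  intro σ
  induction σ with
  | nil => exact fun _ => id
  | cons t σ ih =>
    rintro _ ⟨_, rfl, v, hv, rfl⟩
    rw [ih _ hv]
    rfl

theorem yields_letters [Finite T] (σ : List T) :
    (blockGrammar p x z y τ).Yields (σ.map BlockNT.letter) σ := by
  induction σ with
  | nil => exact .nil
  | cons t σ ih => exact .cons (G := blockGrammar p x z y τ) (BlockProduction.letter t) .nil ih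

theorem yields_core [Finite T] (n : ℕ) : (blockGrammar p x z y τ).Yields [BlockNT.core]
    (List.replicate (n + 1) x ++ z :: List.replicate (n + 1) y) := by
  induction n with
  | zero => exact Grammar.yields_singleton_iff.2 ⟨x, _, _, BlockProduction.turn, yields_letters [z, y], rfl⟩
  | succ n ih =>
    have h : (blockGrammar p x z y τ).Yields [BlockNT.core, BlockNT.letter y] _ :=
      ih.append (yields_letters [y])
    refine Grammar.yields_singleton_iff.2 ⟨x, _, _, BlockProduction.step, h, ?_⟩
    rw [List.replicate_succ (n := n + 1), List.replicate_succ' (n := n + 1) (a := y)]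
    simp

theorem language_blockGrammar [Finite T] : (blockGrammar p x z y τ).language =
    {w | ∃ n, 1 ≤ n ∧ w = p :: (List.replicate n x ++ z :: List.replicate n y ++ τ)} := by
  ext w
  refine (Grammar.derives_nil_iff_yields fun _ _ => id).trans ⟨fun h => ?_, ?_⟩
  · refine h.mem (blockLanguage p x z y τ) ?_
    rintro X t γ (hp : BlockProduction p x z y τ X t γ) u hu
    cases hp with
    | start =>
      obtain ⟨_, ⟨n, hn, rfl⟩, v, hv, rfl⟩ := hu
      exact ⟨n, hn, by rw [mem_prod_letter hv]⟩
    | step =>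
      obtain ⟨_, ⟨n, hn, rfl⟩, _, ⟨_, rfl, _, rfl, rfl⟩, rfl⟩ := hu
      refine ⟨n + 1, by omega, ?_⟩
      rw [List.replicate_succ, List.replicate_succ' (a := y)]
      simp
    | turn =>
      obtain ⟨_, rfl, _, ⟨_, rfl, _, rfl, rfl⟩, rfl⟩ := hu
      exact ⟨1, le_rfl, rfl⟩
    | letter t =>
      obtain rfl : u = [] := hu
      rfl
  · rintro ⟨n, hn, rfl⟩
    obtain ⟨n, rfl⟩ := Nat.exists_eq_add_of_le' hn
    exact Grammar.yields_singleton_iff.2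
      ⟨p, _, _, BlockProduction.start, (yields_core n).append (β := τ.map BlockNT.letter) (yields_letters τ), rfl⟩

theorem setOf_block_mem_TrPCCFL [Finite T] (p x z y : T) (τ : List T) :
    ({w | ∃ n, 1 ≤ n ∧ w = p :: (List.replicate n x ++ z :: List.replicate n y ++ τ)} :
      Language T) ∈ TrPCCFL T :=
  ⟨blockGrammar p x z y τ, fun _ _ _ _ _ => id, language_blockGrammar⟩

theorem isContextFree_setOf_block [Finite T] (p x z y : T) (τ : List T) : Language.IsContextFree
    ({w | ∃ n, 1 ≤ n ∧ w = p :: (List.replicate n x ++ z :: List.replicate n y ++ τ)} :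
      Language T) := by
  rw [← language_blockGrammar]
  exact Grammar.isContextFree_language fun _ _ => id

end Blocks

/-! ### The inverse image of a shuffle -/

instance : Finite Src := by
  refine Set.finite_univ_iff.1 ((Set.toFinite {Src.a, .s, .b, .t, .c}).subset ?_)
  rintro (_ | _ | _ | _ | _) - <;> simp

instance : Finite Tgt := by
  refine Set.finite_univ_iff.1
    ((Set.toFinite {Tgt.A, .S₁, .B₁, .T₁, .S₂, .B₂, .T₂, .C}).subset ?_)
  rintro (_ | _ | _ | _ | _ | _ | _ | _) - <;> simp

/-- The extra `A` is the leading letter `p` of the block shape, leaving `n` copies to match the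
`B₁`. -/
theorem lang₁_eq : lang₁ = {w | ∃ n, 1 ≤ n ∧
    w = Tgt.A :: (List.replicate n .A ++ .S₁ :: List.replicate n .B₁ ++ [.T₁])} := by
  simp only [lang₁, List.replicate_succ, List.append_assoc, List.cons_append, List.nil_append]
  rfl

theorem lang₂_eq : lang₂ = {w | ∃ n, 1 ≤ n ∧
    w = Tgt.S₂ :: (List.replicate n .B₂ ++ .T₂ :: List.replicate n .C ++ [])} := by
  simp only [lang₂, List.append_assoc, List.cons_append, List.nil_append, List.append_nil]
  rfl

theorem isContextFree_lang₁ : lang₁.IsContextFree := by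
  rw [lang₁_eq]
  exact isContextFree_setOf_block ..

theorem isContextFree_lang₂ : lang₂.IsContextFree := by
  rw [lang₂_eq]
  exact isContextFree_setOf_block ..

theorem shuffle_lang_mem_TrPCCFL : shuffle lang₁ lang₂ ∈ TrPCCFL Tgt := by
  rw [lang₁_eq, lang₂_eq]
  exact shuffle_mem_TrPCCFL (setOf_block_mem_TrPCCFL ..) (setOf_block_mem_TrPCCFL ..)

theorem Interleaving.filter {T : Type} (P : T → Bool) (u : List T) :
    Interleaving (u.filter P) (u.filter fun t => !P t) u := by
  induction u with
  | nil => exact .nil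
  | cons t u ih =>
    by_cases h : P t
    · simpa [h] using ih.left t
    · simpa [h] using ih.right t

/-- Over disjoint alphabets an interleaving determines both of its components. -/
theorem Interleaving.eq_filter {T : Type} {P : T → Bool} {w v u : List T}
    (h : Interleaving w v u) (hw : ∀ t ∈ w, P t) (hv : ∀ t ∈ v, P t = false) :
    w = u.filter P ∧ v = u.filter fun t => !P t := by
  induction h with
  | nil => exact ⟨rfl, rfl⟩
  | left t _ ih =>
    simp only [List.forall_mem_cons] at hw
    simpa [hw.1] using ih hw.2 hv
  | right t _ ih =>
    simp only [List.forall_mem_cons] at hv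
    simpa [hv.1] using ih hw hv.2

/-- The letters of the first language. -/
def Tgt.isFirst : Tgt → Bool
  | .A | .S₁ | .B₁ | .T₁ => true
  | _ => false

/-- The letter of the first language in the image of a letter. -/
def Src.first : Src → Option Tgt
  | .a => some .A
  | .s => some .S₁
  | .b => some .B₁
  | .t => some .T₁
  | .c => none

/-- The letter of the second language in the image of a letter. -/
def Src.second : Src → Option Tgt
  | .a => none
  | .s => some .S₂
  | .b => some .B₂
  | .t => some .T₂
  | .c => some .C

theorem filter_isFirst (w : List Src) :
    (w.flatMap hom).filter Tgt.isFirst = w.filterMap Src.first := by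
  induction w with
  | nil => rfl
  | cons x w ih => cases x <;> first | exact ih | exact congrArg (_ :: ·) ih

theorem filter_not_isFirst (w : List Src) :
    ((w.flatMap hom).filter fun t => !t.isFirst) = w.filterMap Src.second := by
  induction w with
  | nil => rfl
  | cons x w ih => cases x <;> first | exact ih | exact congrArg (_ :: ·) ih

/-- As the alphabets of the two languages are disjoint, membership splits into independent
conditions on two projections of `w`. -/
theorem mem_inverseImage_shuffle {w : List Src} : w ∈ inverseImage hom (shuffle lang₁ lang₂) ↔
    w.filterMap Src.first ∈ lang₁ ∧ w.filterMap Src.second ∈ lang₂ := by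
  rw [← filter_isFirst, ← filter_not_isFirst]
  constructor
  · rintro ⟨u, ⟨m, hm, rfl⟩, v, ⟨n, hn, rfl⟩, h⟩
    obtain ⟨h₁, h₂⟩ := h.eq_filter (P := Tgt.isFirst)
      (by simp [or_imp, forall_and, Tgt.isFirst, List.mem_replicate])
      (by simp [or_imp, forall_and, Tgt.isFirst, List.mem_replicate])
    rw [← h₁, ← h₂]
    exact ⟨⟨m, hm, rfl⟩, n, hn, rfl⟩
  · rintro ⟨h₁, h₂⟩
    exact ⟨_, h₁, _, h₂, .filter _ _⟩

/-- Only `a` is invisible to the second projection, which starts with `S₂`; hence nothing but `a`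
precedes the first `s`. -/
theorem split_at_s {k : ℕ} {w : List Src} {u v : List Tgt}
    (h₁ : w.filterMap Src.first = List.replicate k .A ++ .S₁ :: u)
    (h₂ : w.filterMap Src.second = .S₂ :: v) :
    ∃ w', w = List.replicate k .a ++ .s :: w' ∧ w'.filterMap Src.first = u ∧
      w'.filterMap Src.second = v := by
  induction k generalizing w with
  | zero =>
    obtain _ | ⟨x, w⟩ := w
    · simp at h₁
    · cases x <;> simp_all [List.filterMap_cons, Src.first, Src.second]
  | succ k ih =>
    obtain _ | ⟨x, w⟩ := w
    · simp at h₁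
    · cases x <;> simp_all [List.filterMap_cons, Src.first, Src.second, List.replicate_succ]

/-- Both projections see `b` and `t`. An `a` or `c` before the first `t` would show up in one of
them, so they read the same block and `m = n`. -/
theorem split_at_t {m n : ℕ} {w : List Src} {u v : List Tgt}
    (h₁ : w.filterMap Src.first = List.replicate m .B₁ ++ .T₁ :: u)
    (h₂ : w.filterMap Src.second = List.replicate n .B₂ ++ .T₂ :: v) :
    m = n ∧ ∃ w', w = List.replicate m .b ++ .t :: w' ∧ w'.filterMap Src.first = u ∧
      w'.filterMap Src.second = v := by
  induction m generalizing w n with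
  | zero =>
    obtain _ | ⟨x, w⟩ := w
    · simp at h₁
    · cases n <;> cases x <;> simp_all [List.filterMap_cons, Src.first, Src.second, List.replicate_succ]
  | succ m ih =>
    obtain _ | ⟨x, w⟩ := w
    · simp at h₁
    · cases n <;> cases x <;> simp_all [List.filterMap_cons, Src.first, Src.second, List.replicate_succ]
      exact (ih h₁ h₂).1

theorem eq_replicate_c {n : ℕ} {w : List Src} (h₁ : w.filterMap Src.first = [])
    (h₂ : w.filterMap Src.second = List.replicate n .C) : w = List.replicate n .c := by
  induction w generalizing n with
  | nil => cases n <;> simp_all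
  | cons x w ih =>
    cases n <;> cases x <;> simp_all [List.filterMap_cons, Src.first, Src.second, List.replicate_succ]

theorem inverseImage_shuffle : inverseImage hom (shuffle lang₁ lang₂) =
    {w | ∃ n : ℕ, 1 ≤ n ∧ w = List.replicate (n + 1) Src.a ++ [Src.s] ++
      List.replicate n Src.b ++ [Src.t] ++ List.replicate n Src.c} := by
  ext w
  rw [mem_inverseImage_shuffle]
  constructor
  · rintro ⟨⟨m, hm, h₁⟩, n, hn, h₂⟩
    obtain ⟨w, rfl, h₁, h₂⟩ := split_at_s (by simpa using h₁) (by simpa using h₂)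
    obtain ⟨rfl, w, rfl, h₁, h₂⟩ := split_at_t h₁ h₂
    exact ⟨m, hm, by simp [eq_replicate_c h₁ h₂]⟩
  · rintro ⟨n, hn, rfl⟩
    refine ⟨⟨n, hn, ?_⟩, n, hn, ?_⟩
    · simp [Src.first, List.filterMap_append, List.filterMap_replicate]
    · simp [Src.second, List.filterMap_append, List.filterMap_replicate]

theorem inverseImage_shuffle_notMem_PCCFL :
    inverseImage hom (shuffle lang₁ lang₂) ∉ PCCFL Src := by
  classical
  rw [inverseImage_shuffle]
  refine not_mem_PCCFL_of_sorted
    (f := fun x => match x with | .a => 0 | .s => 1 | .b => 2 | .t => 3 | .c => 4)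
    (fun p q h => by cases p <;> cases q <;> simp_all) ?_
    (x := .a) (y := .b) (z := .c) (by simp) (by simp) (by simp) ?_ fun n => ?_
  · rintro _ ⟨n, -, rfl⟩
    simp [List.pairwise_append, List.pairwise_replicate, List.mem_replicate, or_imp, forall_and]
  · rintro _ ⟨n, -, rfl⟩ _ ⟨m, -, rfl⟩ x (rfl | rfl | rfl) h <;>
    · simp [List.count_append, List.count_replicate] at h
      rw [h]
  · exact ⟨_, ⟨n + 1, by omega, rfl⟩, by simp; omega⟩

end PartiallyCommutative

/-! ### Non-closure of both classes -/

open PartiallyCommutative in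
theorem mainTheorem9 :
    -- neither class is closed under intersection with regular languages
    (¬ ClosedUnderInterRegular PCCFL ∧ ¬ ClosedUnderInterRegular TrPCCFL) ∧
    -- the witness for the failure
    (equalCounts ∈ CCFL ABC ∧ equalCounts ∈ TrPCCFL ABC ∧ equalCounts ∈ PCCFL ABC ∧
      aStarBStarCStar.IsRegular ∧
      equalCounts ⊓ aStarBStarCStar =
        {w | ∃ n : ℕ, 1 ≤ n ∧ w = List.replicate n ABC.a ++ List.replicate n ABC.b ++
          List.replicate n ABC.c} ∧
      equalCounts ⊓ aStarBStarCStar ∉ PCCFL ABC) ∧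
    -- neither class is closed under inverse homomorphic images
    (¬ ClosedUnderInverseHom PCCFL ∧ ¬ ClosedUnderInverseHom TrPCCFL) ∧
    -- the witness for the failure: a shuffle of two context-free languages
    (lang₁.IsContextFree ∧ lang₂.IsContextFree ∧
      shuffle lang₁ lang₂ ∈ TrPCCFL Tgt ∧ shuffle lang₁ lang₂ ∈ PCCFL Tgt ∧
      inverseImage hom (shuffle lang₁ lang₂) =
        {w | ∃ n : ℕ, 1 ≤ n ∧ w = List.replicate (n + 1) Src.a ++ [Src.s] ++
          List.replicate n Src.b ++ [Src.t] ++ List.replicate n Src.c} ∧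
      inverseImage hom (shuffle lang₁ lang₂) ∉ PCCFL Src) := by
  have hC := equalCounts_mem_CCFL
  have hTr := CCFL_subset_TrPCCFL _ hC
  have hP := TrPCCFL_subset_PCCFL _ hTr
  have hS := shuffle_lang_mem_TrPCCFL
  have hS' := TrPCCFL_subset_PCCFL _ hS
  have hhom : ∀ x, hom x ≠ [] := by rintro (_ | _ | _ | _ | _) <;> simp [hom]
  refine ⟨⟨fun h => ?_, fun h => ?_⟩,
    ⟨hC, hTr, hP, isRegular_aStarBStarCStar, equalCounts_inf_aStarBStarCStar, inf_notMem_PCCFL⟩,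
    ⟨fun h => ?_, fun h => ?_⟩,
    isContextFree_lang₁, isContextFree_lang₂, hS, hS', inverseImage_shuffle,
    inverseImage_shuffle_notMem_PCCFL⟩
  · exact inf_notMem_PCCFL (h ABC _ _ hP isRegular_aStarBStarCStar)
  · exact inf_notMem_PCCFL (TrPCCFL_subset_PCCFL _ (h ABC _ _ hTr isRegular_aStarBStarCStar))
  · exact inverseImage_shuffle_notMem_PCCFL (h Src Tgt hom hhom _ hS')
  · exact inverseImage_shuffle_notMem_PCCFL
      (TrPCCFL_subset_PCCFL _ (h Src Tgt hom hhom _ hS))
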